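/- Let $\mathbb K$ be a field of characteristic $0$ and $R=\mathbb K[x_1,\dots,x_n]$ with the variables ordered $x_1<\cdots<x_n$. For $F\in R\setminus\mathbb K$, the leading variable $\mathrm{lv}(F)$ is the greatest variable occurring in $F$, and the initial $\mathrm{ini}(F)$ is the leading coefficient of $F$ regarded as a polynomial in $\mathrm{lv}(F)$. A (nontrivial) triangular set is a finite nonempty ordered set $[T_1,\dots,T_r]$ of polynomials in $R\setminus\mathbb K$ with $\mathrm{lv}(T_1)<\cdots<\mathrm{lv}(T_r)$; in addition $[c]$ with $c\in\mathbb K\setminus\{0\}$ is considered as a trivial triangular set. The saturated ideal of a nontrivial triangular set $\mathcal T=[T_1,\dots,T_r]$ is $$\mathrm{sat}(\mathcal T)=\{P\in R:\ P\,J^{i}\in\langle T_1,\dots,T_r\rangle\text{ for some } i\ge 0\},\qquad J=\mathrm{ini}(T_1)\cdots\mathrm{ini}(T_r),$$ and $\mathrm{sat}([c])=\langle 1\rangle$. A nontrivial triangular set $[T_1,\dots,T_r]$ is regular if, for every $i=1,\dots,r$, the initial $\mathrm{ini}(T_i)$ is neither zero nor a zero-divisor in $R/\mathrm{sat}([T_1,\dots,T_{i-1}])$,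 where $\mathrm{sat}([\,])=\langle 0\rangle$; trivial triangular sets are not counted as regular. The W-characteristic set of an ideal $\mathfrak I\subseteq R$ is the subset of the reduced Gröbner basis $\mathcal G$ of $\mathfrak I$, with respect to the lexicographic term order with $x_1<\cdots<x_n$, that consists of the element of $\mathcal G\cap\mathbb K$, if there is one, and, for every $i$ for which $\mathcal G$ has elements with leading variable $x_i$, of the smallest (with respect to the term order) of these elements, ordered by increasing leading variable. Let $\mathcal T$ be a triangular set such that every variable which is not the leading variable of an element of $\mathcal T$ is smaller than all the leading variables of the elements of $\mathcal T$. Let $\mathcal C$ be the W-characteristic set of $\mathrm{sat}(\mathcal T)$. Then $\mathrm{sat}(\mathcal T)$ is equiprojectable, i.e. $\mathrm{sat}(\mathcal T)=\mathrm{sat}(\bar{\mathcal T})$ for some regular triangular set $\bar{\mathcal T}$ (with respect to the same variable ordering), if and only if $\mathcal C$ is regular and $\mathrm{sat}(\mathcal T)=\mathrm{sat}(\mathcal C)$. -/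

import Mathlib

open MvPolynomial
open scoped MonomialOrder

namespace TriSet

noncomputable section

/-! ### Reduced Gröbner bases -/

section Groebner

variable {σ K : Type*} [Field K]

/-- The finite set `G ⊆ I` is a Gröbner basis of the ideal `I` for the term order `m`:
the leading terms of the elements of `G` generate the ideal generated by the leading terms of
all the elements of `I`. -/
def IsGroebnerBasis (m : MonomialOrder σ) (I : Ideal (MvPolynomial σ K))
    (G : Finset (MvPolynomial σ K)) : Prop :=
  (∀ g ∈ G, g ∈ I) ∧
    Ideal.span (m.leadingTerm '' (G : Set (MvPolynomial σ K))) =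
      Ideal.span (m.leadingTerm '' (I : Set (MvPolynomial σ K)))

/-- The Gröbner basis `G` is reduced: its elements are monic, and no term of an element of `G` is
divisible by the leading term of another element of `G`. -/
def IsReducedGroebnerBasis (m : MonomialOrder σ) (I : Ideal (MvPolynomial σ K))
    (G : Finset (MvPolynomial σ K)) : Prop :=
  IsGroebnerBasis m I G ∧ (∀ g ∈ G, m.Monic g) ∧
    ∀ g ∈ G, ∀ h ∈ G, h ≠ g → ∀ c ∈ g.support, ¬ m.degree h ≤ c

theorem IsReducedGroebnerBasis.exists_degree_le {m : MonomialOrder σ}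
    {I : Ideal (MvPolynomial σ K)} {G : Finset (MvPolynomial σ K)}
    (hG : IsReducedGroebnerBasis m I G) {f : MvPolynomial σ K} (hf : f ∈ I) (h0 : f ≠ 0) :
    ∃ g ∈ G, m.degree g ≤ m.degree f := by
  have h1 : m.leadingTerm f ∈
      Ideal.span (m.leadingTerm '' (G : Set (MvPolynomial σ K))) := by
    rw [hG.1.2]
    exact Ideal.subset_span ⟨f, hf, rfl⟩
  have h2 : m.leadingTerm '' (G : Set (MvPolynomial σ K)) =
      (fun s => monomial s (1 : K)) '' (m.degree '' (G : Set (MvPolynomial σ K))) := by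
    rw [Set.image_image]
    refine Set.image_congr fun g hg => ?_
    rw [MonomialOrder.leadingTerm, (hG.2.1 g hg).leadingCoeff_eq_one]
  rw [h2, mem_ideal_span_monomial_image] at h1
  obtain ⟨_, ⟨g, hg, rfl⟩, hle⟩ := h1 (m.degree f) (by
    rw [m.support_leadingTerm' h0]; simp)
  exact ⟨g, hg, hle⟩

theorem IsReducedGroebnerBasis.subset {m : MonomialOrder σ}
    {I : Ideal (MvPolynomial σ K)} {G G' : Finset (MvPolynomial σ K)}
    (hG : IsReducedGroebnerBasis m I G) (hG' : IsReducedGroebnerBasis m I G') : G ⊆ G' := by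
  classical
  have key : ∀ {H : Finset (MvPolynomial σ K)}, IsReducedGroebnerBasis m I H →
      ∀ h ∈ H, ∀ p ∈ I, p ≠ 0 → m.degree p ∈ h.support → m.degree p = m.degree h := by
    intro H hH h hh p hp p0 hs
    obtain ⟨q, hq, hle⟩ := hH.exists_degree_le hp p0
    by_cases hqh : q = h
    · subst hqh
      exact m.toSyn.injective (le_antisymm (m.le_degree hs) (m.toSyn_monotone hle))
    · exact absurd hle (hH.2.2 h hh q hq hqh _ hs)
  intro g hg
  have hgI := hG.1.1 g hg
  have g0 : g ≠ 0 := (hG.2.1 g hg).ne_zero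
  obtain ⟨g', hg', h1⟩ := hG'.exists_degree_le hgI g0
  have hgI' := hG'.1.1 g' hg'
  have g0' : g' ≠ 0 := (hG'.2.1 g' hg').ne_zero
  obtain ⟨g'', hg'', h2⟩ := hG.exists_degree_le hgI' g0'
  have hgg : g'' = g := by
    by_contra hne
    exact hG.2.2 g hg g'' hg'' hne _ (m.degree_mem_support g0) (h2.trans h1)
  subst hgg
  have hd : m.degree g' = m.degree g'' := le_antisymm h1 h2
  suffices hz : g'' - g' = 0 by rwa [sub_eq_zero.1 hz]
  by_contra hz
  have hI : g'' - g' ∈ I := I.sub_mem hgI hgI'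
  have hmem := m.degree_mem_support hz
  have hne : m.degree (g'' - g') ≠ m.degree g'' := by
    intro he
    rw [he, mem_support_iff, coeff_sub, (hG.2.1 _ hg).coeff_degree, ← hd,
      (hG'.2.1 _ hg').coeff_degree] at hmem
    simp at hmem
  rcases Finset.mem_union.1 (support_sub _ _ _ hmem) with h | h
  · exact hne (key hG _ hg _ hI hz h)
  · exact hne ((key hG' _ hg' _ hI hz h).trans hd)

/-- Every ideal has exactly one reduced Gröbner basis. -/
theorem existsUnique_isReducedGroebnerBasis [Finite σ] (m : MonomialOrder σ)
    (I : Ideal (MvPolynomial σ K)) : ∃! G, IsReducedGroebnerBasis m I G := by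
  classical
  have hex : ∃ G, IsReducedGroebnerBasis m I G := by
    set S : Set (σ →₀ ℕ) := {d | ∃ f ∈ I, f ≠ 0 ∧ m.degree f = d} with hS
    have hup : ∀ d ∈ S, ∀ e, d ≤ e → e ∈ S := by
      rintro d ⟨f, hf, f0, rfl⟩ e hle
      have hm : (monomial (e - m.degree f) (1 : K)) ≠ 0 := by simp
      refine ⟨monomial (e - m.degree f) 1 * f, I.mul_mem_left _ hf, mul_ne_zero hm f0, ?_⟩
      rw [m.degree_mul hm f0, m.degree_monomial, if_neg one_ne_zero, tsub_add_cancel_of_le hle]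
    have hfin : {d | Minimal (· ∈ S) d}.Finite :=
      WellQuasiOrderedLE.finite_of_isAntichain (setOfPred_minimal_antichain _)
    have hbelow : ∀ d ∈ S, ∃ e ≤ d, Minimal (· ∈ S) e := fun d hd =>
      exists_minimal_le_of_wellFoundedLT (· ∈ S) d hd
    have hpoly : ∀ d ∈ S, ∃ f ∈ I, m.Monic f ∧ m.degree f = d ∧
        ∀ c ∈ f.support, c ∈ S → c = d := by
      rintro d ⟨f, hf, f0, hfd⟩
      obtain ⟨q, r, hq, -, hr⟩ := m.div_set (B := {b | b ∈ I ∧ b ≠ 0})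
        (fun b hb => by
          rw [isUnit_iff_ne_zero, Ne, m.leadingCoeff_eq_zero_iff]; exact hb.2)
        (C (m.leadingCoeff f)⁻¹ * f - monomial d 1)
      have hrS : ∀ c ∈ r.support, c ∉ S := by
        rintro c hc ⟨b, hb, b0, rfl⟩
        exact hr _ hc b ⟨hb, b0⟩ le_rfl
      have hmem : monomial d 1 + r ∈ I := by
        have : monomial d 1 + r = C (m.leadingCoeff f)⁻¹ * f -
            Finsupp.linearCombination (MvPolynomial σ K)
              (fun b : {b | b ∈ I ∧ b ≠ 0} => (b : MvPolynomial σ K)) q := by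
          linear_combination - hq
        rw [this]
        refine I.sub_mem (I.mul_mem_left _ hf) ?_
        rw [Finsupp.linearCombination_apply]
        exact I.sum_mem fun b _ => I.mul_mem_left _ b.2.1
      have hdS : d ∈ S := ⟨f, hf, f0, hfd⟩
      have hrd : coeff d r = 0 := by
        by_contra h
        exact hrS d (mem_support_iff.2 h) hdS
      have hcd : coeff d (monomial d 1 + r) = 1 := by simp [hrd]
      have hsup : ∀ c ∈ (monomial d (1 : K) + r).support, c ∈ S → c = d := by
        intro c hc hcS
        by_contra hne
        refine hrS c ?_ hcS
        rw [mem_support_iff, coeff_add, coeff_monomial, if_neg (Ne.symm hne), zero_add] at hc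
        exact mem_support_iff.2 hc
      have hne0 : monomial d (1 : K) + r ≠ 0 := by
        intro h
        rw [h] at hcd
        simp at hcd
      have hdeg : m.degree (monomial d (1 : K) + r) = d :=
        hsup _ (m.degree_mem_support hne0) ⟨_, hmem, hne0, rfl⟩
      refine ⟨_, hmem, ?_, hdeg, hsup⟩
      rw [MonomialOrder.Monic, MonomialOrder.leadingCoeff, hdeg, hcd]
    choose! F hFI hFm hFd hFs using hpoly
    refine ⟨hfin.toFinset.image F, ⟨?_, ?_⟩, ?_, ?_⟩
    · intro g hg
      obtain ⟨d, hd, rfl⟩ := Finset.mem_image.1 hg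
      exact hFI d ((hfin.mem_toFinset).1 hd).1
    · apply le_antisymm
      · apply Ideal.span_mono
        apply Set.image_mono
        intro g hg
        obtain ⟨d, hd, rfl⟩ := Finset.mem_image.1 (Finset.mem_coe.1 hg)
        exact hFI d ((hfin.mem_toFinset).1 hd).1
      · rw [Ideal.span_le]
        rintro _ ⟨f, hf, rfl⟩
        by_cases f0 : f = 0
        · rw [f0, m.leadingTerm_zero]
          exact Ideal.zero_mem _
        obtain ⟨e, hle, he⟩ := hbelow (m.degree f) ⟨f, hf, f0, rfl⟩
        have hlt : m.leadingTerm f = monomial (m.degree f - e) (m.leadingCoeff f) *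
            m.leadingTerm (F e) := by
          rw [MonomialOrder.leadingTerm, MonomialOrder.leadingTerm, hFd e he.1,
            (hFm e he.1).leadingCoeff_eq_one, monomial_mul, mul_one, tsub_add_cancel_of_le hle]
        rw [SetLike.mem_coe, hlt]
        refine Ideal.mul_mem_left _ _ (Ideal.subset_span ⟨F e, ?_, rfl⟩)
        exact Finset.mem_coe.2 (Finset.mem_image.2 ⟨e, (hfin.mem_toFinset).2 he, rfl⟩)
    · intro g hg
      obtain ⟨d, hd, rfl⟩ := Finset.mem_image.1 hg
      exact hFm d ((hfin.mem_toFinset).1 hd).1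
    · intro g hg h hh hne c hc hle
      obtain ⟨d, hd, rfl⟩ := Finset.mem_image.1 hg
      obtain ⟨e, he, rfl⟩ := Finset.mem_image.1 hh
      have hd' := (hfin.mem_toFinset).1 hd
      have he' := (hfin.mem_toFinset).1 he
      rw [hFd e he'.1] at hle
      have hcd := hFs d hd'.1 c hc (hup e he'.1 c hle)
      subst hcd
      exact hne (by rw [le_antisymm hle (hd'.2 he'.1 hle)])
  obtain ⟨G, hG⟩ := hex
  exact ⟨G, hG, fun G' hG' => Finset.Subset.antisymm (hG'.subset hG) (hG.subset hG')⟩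

/-- The reduced Gröbner basis of `I` for the term order `m`. -/
def reducedGroebnerBasis [Finite σ] (m : MonomialOrder σ) (I : Ideal (MvPolynomial σ K)) :
    Finset (MvPolynomial σ K) :=
  (existsUnique_isReducedGroebnerBasis m I).choose

theorem reducedGroebnerBasis_spec [Finite σ] (m : MonomialOrder σ)
    (I : Ideal (MvPolynomial σ K)) :
    IsReducedGroebnerBasis m I (reducedGroebnerBasis m I) :=
  (existsUnique_isReducedGroebnerBasis m I).choose_spec.1

end Groebner

/-! ### The lexicographic term order with `x₁ < ⋯ < xₙ` -/

/-- The lexicographic term order on the monomials in the variables `X 0 < X 1 < ⋯ < X (n-1)`.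
(`MonomialOrder.lex` takes `X 0` as the greatest variable, hence `Colex`.) -/
def lexOrder (n : ℕ) : MonomialOrder (Fin n) where
  syn := Colex (Fin n →₀ ℕ)
  toSyn :=
  { toEquiv := toColex
    map_add' := toColex_add }
  toSyn_monotone := Finsupp.toColex_monotone

/-- `a` is lexicographically smaller than `b` iff `a` has the smaller exponent at the greatest
variable where they differ. -/
theorem lexOrder_lt_iff {n : ℕ} {a b : Fin n →₀ ℕ} :
    a ≺[lexOrder n] b ↔ ∃ i, (∀ j, i < j → a j = b j) ∧ a i < b i :=
  Finsupp.Colex.lt_iff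

/-! ### Triangular sets -/

section Triangular

variable {K : Type*} [Field K] {n : ℕ}

/-- The leading variable of `P`: the greatest variable that occurs in `P`. It is `⊥` exactly when
`P` is a constant. -/
def leadVar (P : MvPolynomial (Fin n) K) : WithBot (Fin n) := P.vars.max

/-- The coefficient of `(X i) ^ k` in `P`, where `P` is regarded as a polynomial in `X i`. -/
def coeffIn (i : Fin n) (k : ℕ) (P : MvPolynomial (Fin n) K) : MvPolynomial (Fin n) K :=
  ∑ d ∈ P.support with d i = k, monomial (d.erase i) (P.coeff d)

/-- The initial of `P`: the leading coefficient of `P` with respect to its leading variable.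
(By convention it is `P` itself if `P` is a constant.) -/
def initial (P : MvPolynomial (Fin n) K) : MvPolynomial (Fin n) K :=
  if h : P.vars.Nonempty then coeffIn (P.vars.max' h) (P.degreeOf (P.vars.max' h)) P else P

/-- A (nontrivial) triangular set `[T₁, …, Tᵣ]`: finitely many, but at least one, nonconstant
polynomials with `lv T₁ < ⋯ < lv Tᵣ`. As the leading variables have to be distinct and fix the
ordering, it is given by its underlying finite set. -/
def IsTriangularSet (T : Finset (MvPolynomial (Fin n) K)) : Prop :=
  T.Nonempty ∧ (∀ P ∈ T, leadVar P ≠ ⊥) ∧ ∀ P ∈ T, ∀ Q ∈ T, leadVar P = leadVar Q → P = Q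

/-- A trivial triangular set `[c]`, where `c` is a nonzero constant. -/
def IsTrivialTriangularSet (T : Finset (MvPolynomial (Fin n) K)) : Prop :=
  ∃ c : K, c ≠ 0 ∧ T = {C c}

/-- The saturated ideal of `T`: all the `P` for which `P * J ^ i` is in the ideal generated by `T`
for some `i`, where `J` is the product of the initials of the elements of `T`.
It is the unit ideal for a trivial triangular set, and the zero ideal for the empty set. -/
def sat (T : Finset (MvPolynomial (Fin n) K)) : Ideal (MvPolynomial (Fin n) K) where
  carrier := {P | ∃ i : ℕ, P * (∏ Q ∈ T, initial Q) ^ i ∈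
    Ideal.span (T : Set (MvPolynomial (Fin n) K))}
  zero_mem' := ⟨0, by simp⟩
  add_mem' := by
    rintro P Q ⟨i, hi⟩ ⟨j, hj⟩
    refine ⟨i + j, ?_⟩
    have h : (P + Q) * (∏ Q ∈ T, initial Q) ^ (i + j) =
        (∏ Q ∈ T, initial Q) ^ j * (P * (∏ Q ∈ T, initial Q) ^ i) +
        (∏ Q ∈ T, initial Q) ^ i * (Q * (∏ Q ∈ T, initial Q) ^ j) := by ring
    rw [h]
    exact Ideal.add_mem _ (Ideal.mul_mem_left _ _ hi) (Ideal.mul_mem_left _ _ hj)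
  smul_mem' := by
    rintro A P ⟨i, hi⟩
    exact ⟨i, by rw [smul_eq_mul, mul_assoc]; exact Ideal.mul_mem_left _ _ hi⟩

/-- A regular set (regular chain): a nontrivial triangular set `[T₁, …, Tᵣ]` such that, for each
`i`, the initial of `Tᵢ` is neither zero nor a zero-divisor modulo `sat [T₁, …, Tᵢ₋₁]`.
Here `[T₁, …, Tᵢ₋₁]` is the set of the elements with leading variable below that of `Tᵢ`. -/
def IsRegularSet (T : Finset (MvPolynomial (Fin n) K)) : Prop :=
  IsTriangularSet T ∧ ∀ P ∈ T,
    Ideal.Quotient.mk (sat {Q ∈ T | leadVar Q < leadVar P}) (initial P) ≠ 0 ∧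
    Ideal.Quotient.mk (sat {Q ∈ T | leadVar Q < leadVar P}) (initial P) ∈
      nonZeroDivisors (MvPolynomial (Fin n) K ⧸ sat {Q ∈ T | leadVar Q < leadVar P})

/-- The W-characteristic set of `I`: from the reduced lexicographic Gröbner basis of `I` one takes,
for each leading variable that occurs in it, the smallest element with that leading variable.
(It is `{1}` for the unit ideal and empty for the zero ideal.) -/
def wCharSet (I : Ideal (MvPolynomial (Fin n) K)) : Finset (MvPolynomial (Fin n) K) :=
  {P ∈ reducedGroebnerBasis (lexOrder n) I |
    ∀ Q ∈ reducedGroebnerBasis (lexOrder n) I, leadVar Q = leadVar P →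
      (lexOrder n).degree P ≼[lexOrder n] (lexOrder n).degree Q}

/-- The variable ordering condition: every parameter of `T` (a variable that is not the leading
variable of an element of `T`) is smaller than every leading variable of an element of `T`. -/
def VariableOrderingCondition (T : Finset (MvPolynomial (Fin n) K)) : Prop :=
  ∀ i j : Fin n, (∀ P ∈ T, leadVar P ≠ i) → (∃ P ∈ T, leadVar P = j) → i < j

/-- The ideal `I` is equiprojectable: it is the saturated ideal of a regular set. -/
def IsEquiprojectable (I : Ideal (MvPolynomial (Fin n) K)) : Prop :=
  ∃ T : Finset (MvPolynomial (Fin n) K), IsRegularSet T ∧ I = sat T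

end Triangular

end

end TriSet

/-!
A set `T` with distinct leading variables is built up by adjoining polynomials with increasing
leading variables, and `sat (insert t S)` is the saturation of `⟨sat S, t⟩` by the initial of `t`.
By induction, nonzero polynomials in the parameters of `T` are regular modulo `sat T`, each variable
is algebraic over the parameters modulo `sat T`, and, if `T` is a regular set, only `0` is in `sat
T` and reduced modulo `T`.

Let `T` be a regular set whose parameters are the smallest variables, and let `t ∈ T` have the
leading variable `X j`. Modulo `sat T` the initial of `t` divides a nonzero polynomial in the
parameters, so the leading monomials of `sat T` include a monomial in the parameters times `X j ^
degreeOf j t`. On the other hand, an element of the reduced Gröbner basis with leading variable `X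
j` and smaller degree in it would have its initial in `sat T`. Hence the element of the
W-characteristic set with leading variable `X j` has the same degree in `X j` as `t`, and its
initial involves parameters only. The W-characteristic set is therefore regular, and pseudo-division
by it leaves remainders that are reduced modulo `T`, so that its saturated ideal is `sat T`.

Finally, `sat T` alone determines the parameters of `T`, provided that they are the smallest
variables; so the condition on the variables carries over to each regular set with the same
saturated ideal.
-/

namespace TriSet

noncomputable section

variable {K : Type*} [Field K] {n : ℕ} {S T : Finset (MvPolynomial (Fin n) K)}
  {P Q t : MvPolynomial (Fin n) K} {i j : Fin n}

/-! ### Univariate views -/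

/-- `P` regarded as a univariate polynomial in `X j`. The coefficients, which do not involve `X j`,
are kept in the same ring. -/
def toPoly (j : Fin n) :
    MvPolynomial (Fin n) K →ₐ[K] Polynomial (MvPolynomial (Fin n) K) :=
  aeval fun i => if i = j then Polynomial.X else Polynomial.C (X i)

theorem toPoly_X (j : Fin n) : toPoly (K := K) j (X j) = Polynomial.X := by simp [toPoly]

theorem toPoly_monomial (j : Fin n) (d : Fin n →₀ ℕ) (a : K) :
    toPoly j (monomial d a) = Polynomial.monomial (d j) (monomial (d.erase j) a) := by
  have hprod : (d.prod fun i k => (if i = j then (Polynomial.X : Polynomial (MvPolynomial _ K))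
      else Polynomial.C (X i)) ^ k) =
      Polynomial.X ^ d j * Polynomial.C ((d.erase j).prod fun i k => X i ^ k) := by
    rw [← Finsupp.mul_prod_erase' d j _ (fun i => pow_zero _), map_finsuppProd, if_pos rfl]
    congr 1
    refine Finsupp.prod_congr fun i hi => ?_
    rw [if_neg (by rintro rfl; simp at hi), map_pow]
  rw [toPoly, aeval_monomial, hprod, monomial_eq, ← Polynomial.C_mul_X_pow_eq_monomial,
    Polynomial.C_mul, Polynomial.algebraMap_apply, MvPolynomial.algebraMap_eq]
  ring

theorem coeff_toPoly (j : Fin n) (k : ℕ) (P : MvPolynomial (Fin n) K) :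
    (toPoly j P).coeff k = coeffIn j k P := by
  conv_lhs => rw [P.as_sum]
  rw [map_sum, Polynomial.finsetSum_coeff, coeffIn, Finset.sum_filter]
  refine Finset.sum_congr rfl fun d _ => ?_
  rw [toPoly_monomial, Polynomial.coeff_monomial]

theorem eval_toPoly (j : Fin n) (P : MvPolynomial (Fin n) K) :
    (toPoly j P).eval (X j) = P := by
  induction P using MvPolynomial.induction_on with
  | C a => simp [toPoly]
  | add p q hp hq => rw [map_add, Polynomial.eval_add, hp, hq]
  | mul_X p i hp =>
    rw [map_mul, Polynomial.eval_mul, hp]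
    by_cases h : i = j <;> simp [toPoly, h]

theorem toPoly_injective (j : Fin n) : Function.Injective (toPoly (K := K) j) :=
  Function.LeftInverse.injective (eval_toPoly j)

theorem toPoly_eq_C (h : degreeOf j P = 0) : toPoly j P = Polynomial.C P := by
  conv_lhs => rw [P.as_sum]
  conv_rhs => rw [P.as_sum]
  rw [map_sum, map_sum]
  refine Finset.sum_congr rfl fun d hd => ?_
  have hj : d j = 0 := Nat.le_zero.1 (h ▸ monomial_le_degreeOf j hd)
  rw [toPoly_monomial, hj, Polynomial.monomial_zero_left,
    Finsupp.erase_of_notMem_support (by simpa using hj)]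

theorem exists_of_mem_support_coeffIn {k : ℕ} {s : Fin n →₀ ℕ} (hs : s ∈ (coeffIn j k P).support) :
    ∃ d ∈ P.support, d j = k ∧ s = d.erase j := by
  classical
  obtain ⟨d, hd, hsd⟩ := Finset.mem_biUnion.1 (support_sum hs)
  obtain ⟨hdP, hdk⟩ := Finset.mem_filter.1 hd
  exact ⟨d, hdP, hdk, Finset.mem_singleton.1 (support_monomial_subset hsd)⟩

theorem degreeOf_coeffIn_le (i j : Fin n) (k : ℕ) (P : MvPolynomial (Fin n) K) :
    degreeOf i (coeffIn j k P) ≤ degreeOf i P := by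
  refine degreeOf_le_iff.2 fun s hs => ?_
  obtain ⟨d, hd, -, rfl⟩ := exists_of_mem_support_coeffIn hs
  refine le_trans ?_ (monomial_le_degreeOf i hd)
  rw [Finsupp.erase_apply]
  split_ifs
  exacts [Nat.zero_le _, le_rfl]

theorem degreeOf_self_coeffIn (j : Fin n) (k : ℕ) (P : MvPolynomial (Fin n) K) :
    degreeOf j (coeffIn j k P) = 0 := by
  refine Nat.le_zero.1 (degreeOf_le_iff.2 fun s hs => ?_)
  obtain ⟨d, -, -, rfl⟩ := exists_of_mem_support_coeffIn hs
  simp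

theorem natDegree_toPoly (j : Fin n) (P : MvPolynomial (Fin n) K) :
    (toPoly j P).natDegree = degreeOf j P := by
  apply le_antisymm
  · rw [Polynomial.natDegree_le_iff_coeff_eq_zero]
    intro k hk
    rw [coeff_toPoly, coeffIn, Finset.filter_false_of_mem, Finset.sum_empty]
    exact fun d hd => ((monomial_le_degreeOf j hd).trans_lt hk).ne
  · conv_lhs => rw [← eval_toPoly j P, Polynomial.eval_eq_sum_range]
    refine (degreeOf_sum_le _ _ _).trans (Finset.sup_le fun k hk => ?_)
    rw [coeff_toPoly]
    refine (degreeOf_mul_le _ _ _).trans ?_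
    rw [degreeOf_self_coeffIn, zero_add, degreeOf_X_self_pow]
    exact Finset.mem_range_succ_iff.1 hk

theorem leadingCoeff_toPoly (j : Fin n) (P : MvPolynomial (Fin n) K) :
    (toPoly j P).leadingCoeff = coeffIn j (degreeOf j P) P := by
  rw [Polynomial.leadingCoeff, natDegree_toPoly, coeff_toPoly]

theorem mem_of_coeffIn_mem {I : Ideal (MvPolynomial (Fin n) K)} (j : Fin n)
    (h : ∀ k, coeffIn j k P ∈ I) : P ∈ I := by
  rw [← eval_toPoly j P, Polynomial.eval_eq_sum_range]
  exact I.sum_mem fun k _ => I.mul_mem_right _ (coeff_toPoly j k P ▸ h k)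

/-! ### Leading variables and initials -/

theorem leadVar_eq_coe_iff : leadVar P = j ↔ degreeOf j P ≠ 0 ∧ ∀ i, j < i → degreeOf i P = 0 := by
  have hvars : ∀ i, degreeOf i P = 0 ↔ i ∉ P.vars := fun i => by
    rw [mem_vars_iff_degreeOf_ne_zero, not_not]
  simp only [leadVar, Ne, hvars, not_not]
  refine ⟨fun h => ⟨Finset.mem_of_max h, fun i hij hi => ?_⟩, fun ⟨hj, hlt⟩ => le_antisymm ?_ ?_⟩
  · exact (Finset.le_max_of_eq hi h).not_gt hij
  · exact Finset.max_le fun i hi => WithBot.coe_le_coe.2 (not_lt.1 fun hji => hlt i hji hi)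
  · exact Finset.le_max hj

theorem degreeOf_eq_zero_of_leadVar_lt (h : leadVar P < i) : degreeOf i P = 0 :=
  not_ne_iff.1 fun hi => (Finset.le_max (mem_vars_iff_degreeOf_ne_zero.2 hi)).not_gt h

theorem initial_eq (h : leadVar P = j) : initial P = coeffIn j (degreeOf j P) P := by
  have hne : P.vars.Nonempty := ⟨j, Finset.mem_of_max h⟩
  have hj : P.vars.max' hne = j := WithBot.coe_injective ((Finset.coe_max' hne).trans h)
  rw [initial, dif_pos hne, hj]

theorem ne_zero_of_leadVar_eq (h : leadVar P = j) : P ≠ 0 := by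
  rintro rfl
  exact (leadVar_eq_coe_iff.1 h).1 (degreeOf_zero j)

theorem initial_ne_zero (h : leadVar P = j) : initial P ≠ 0 := by
  rw [initial_eq h, ← leadingCoeff_toPoly, Polynomial.leadingCoeff_ne_zero,
    map_ne_zero_iff _ (toPoly_injective j)]
  exact ne_zero_of_leadVar_eq h

theorem degreeOf_initial_le (i : Fin n) (P : MvPolynomial (Fin n) K) :
    degreeOf i (initial P) ≤ degreeOf i P := by
  rw [initial]
  split_ifs
  exacts [degreeOf_coeffIn_le _ _ _ _, le_rfl]

theorem degreeOf_initial_eq_zero (h : leadVar P = j) (hij : j ≤ i) :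
    degreeOf i (initial P) = 0 := by
  rcases hij.eq_or_lt with rfl | hij
  · rw [initial_eq h, degreeOf_self_coeffIn]
  · exact Nat.le_zero.1 ((leadVar_eq_coe_iff.1 h).2 i hij ▸ degreeOf_initial_le i P)

/-! ### Regular elements and saturations -/

section Ideal

variable {A : Type*} [CommRing A]

/-- The elements of `A` that are regular modulo `I`: their classes are non-zero-divisors of
`A ⧸ I`. -/
def regularElements (I : Ideal A) : Submonoid A :=
  (nonZeroDivisors (A ⧸ I)).comap (Ideal.Quotient.mk I)

theorem mem_regularElements_iff {I : Ideal A} {c : A} :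
    c ∈ regularElements I ↔ ∀ a, a * c ∈ I → a ∈ I := by
  rw [regularElements, Submonoid.mem_comap, mem_nonZeroDivisors_iff_right,
    Ideal.Quotient.mk_surjective.forall]
  simp only [← map_mul, Ideal.Quotient.eq_zero_iff_mem]

theorem mem_regularElements_of_dvd {I : Ideal A} {a b : A} (hb : b ∈ regularElements I)
    (h : a ∣ b) : a ∈ regularElements I := by
  obtain ⟨d, rfl⟩ := h
  rw [regularElements, Submonoid.mem_comap, map_mul, mul_mem_nonZeroDivisors] at hb
  exact hb.1

/-- The saturation `I : J^∞` of `I` by `J`. -/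
def saturation (I : Ideal A) (J : A) : Ideal A where
  carrier := {a | ∃ i : ℕ, a * J ^ i ∈ I}
  zero_mem' := ⟨0, by simp⟩
  add_mem' := by
    rintro a b ⟨i, hi⟩ ⟨j, hj⟩
    refine ⟨i + j, ?_⟩
    have h : (a + b) * J ^ (i + j) = J ^ j * (a * J ^ i) + J ^ i * (b * J ^ j) := by ring
    rw [h]
    exact I.add_mem (I.mul_mem_left _ hi) (I.mul_mem_left _ hj)
  smul_mem' := by
    rintro b a ⟨i, hi⟩
    exact ⟨i, by rw [smul_eq_mul, mul_assoc]; exact I.mul_mem_left _ hi⟩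

theorem le_saturation (I : Ideal A) (J : A) : I ≤ saturation I J :=
  fun a ha => ⟨0, by simpa using ha⟩

theorem self_mem_regularElements_saturation (I : Ideal A) (J : A) :
    J ∈ regularElements (saturation I J) := by
  rw [mem_regularElements_iff]
  rintro a ⟨i, hi⟩
  exact ⟨i + 1, by rwa [pow_succ', ← mul_assoc]⟩

theorem saturation_le {I I' : Ideal A} {J : A} (h : I ≤ I') (hJ : J ∈ regularElements I') :
    saturation I J ≤ I' := fun a ⟨i, hi⟩ =>
  mem_regularElements_iff.1 (pow_mem hJ i) a (h hi)

theorem mem_regularElements_saturation_of_mem {I : Ideal A} {J c : A}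
    (hc : c ∈ regularElements I) : c ∈ regularElements (saturation I J) := by
  rw [mem_regularElements_iff] at hc ⊢
  rintro a ⟨i, hi⟩
  exact ⟨i, hc _ (by rwa [mul_right_comm])⟩

end Ideal

theorem sat_eq_saturation (T : Finset (MvPolynomial (Fin n) K)) :
    sat T = saturation (Ideal.span T) (∏ P ∈ T, initial P) :=
  rfl

theorem mem_sat_of_mem (hP : P ∈ T) : P ∈ sat T := by
  rw [sat_eq_saturation]
  exact le_saturation _ _ (Ideal.subset_span hP)

theorem initial_mem_regularElements_sat (hP : P ∈ T) : initial P ∈ regularElements (sat T) := by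
  rw [sat_eq_saturation]
  exact mem_regularElements_of_dvd (self_mem_regularElements_saturation _ _)
    (Finset.dvd_prod_of_mem _ hP)

theorem sat_le {I : Ideal (MvPolynomial (Fin n) K)} (hT : ∀ P ∈ T, P ∈ I)
    (hreg : ∀ P ∈ T, initial P ∈ regularElements I) : sat T ≤ I := by
  rw [sat_eq_saturation]
  exact saturation_le (Ideal.span_le.2 hT) (prod_mem hreg)

theorem sat_mono (h : S ⊆ T) : sat S ≤ sat T :=
  sat_le (fun _ hP => mem_sat_of_mem (h hP)) fun _ hP => initial_mem_regularElements_sat (h hP)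

theorem sat_empty : sat (∅ : Finset (MvPolynomial (Fin n) K)) = ⊥ :=
  le_bot_iff.1 (sat_le (by simp) (by simp))

/-! ### Pseudo-reduction -/

theorem exists_degreeOf_lt_of_degreeOf_le (ht : leadVar t = j) (hP : degreeOf j t ≤ degreeOf j P) :
    ∃ R, initial t * P - R ∈ Ideal.span {t} ∧ degreeOf j R < degreeOf j P ∧
      ∀ i, j < i → degreeOf i R ≤ degreeOf i P := by
  set lc := coeffIn j (degreeOf j P) P
  set e := degreeOf j P - degreeOf j t
  have hzero := (leadVar_eq_coe_iff.1 ht).2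
  refine ⟨initial t * P - lc * X j ^ e * t, ?_, ?_, fun i hi => ?_⟩
  · rw [sub_sub_cancel]
    exact Ideal.mul_mem_left _ _ (Ideal.mem_span_singleton_self t)
  · have hcancel : toPoly j (initial t * P - lc * X j ^ e * t) =
        (toPoly j t).cancelLeads (toPoly j P) := by
      rw [Polynomial.cancelLeads, leadingCoeff_toPoly, leadingCoeff_toPoly, natDegree_toPoly,
        natDegree_toPoly, tsub_eq_zero_of_le hP, pow_zero, mul_one, ← initial_eq ht, map_sub,
        map_mul, map_mul, map_mul, map_pow, toPoly_X, toPoly_eq_C (degreeOf_self_coeffIn _ _ _),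
        toPoly_eq_C (degreeOf_initial_eq_zero ht le_rfl)]
    simp only [← natDegree_toPoly, hcancel] at hP ⊢
    refine Polynomial.natDegree_cancelLeads_lt_of_natDegree_le_natDegree hP (hP.trans_lt' ?_)
    rw [natDegree_toPoly]
    exact Nat.pos_of_ne_zero (leadVar_eq_coe_iff.1 ht).1
  · refine (degreeOf_sub_le _ _ _).trans (max_le ?_ ?_)
    · refine (degreeOf_mul_le _ _ _).trans ?_
      rw [degreeOf_initial_eq_zero ht hi.le, zero_add]
    · refine (degreeOf_mul_le _ _ _).trans ?_
      rw [hzero i hi, add_zero, degreeOf_mul_X_pow_of_ne _ hi.ne']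
      exact degreeOf_coeffIn_le _ _ _ _

theorem toColex_lt_toColex {ι α : Type*} [LinearOrder ι] [WellFoundedGT ι] [LinearOrder α]
    {a b : ι → α} {j : ι} (hj : a j < b j) (hle : ∀ i, j < i → a i ≤ b i) :
    toColex a < toColex b := by
  by_contra hba
  rcases (not_lt.1 hba).eq_or_lt with heq | ⟨i, heq, hi⟩
  · exact hj.ne' (congrFun (toColex.injective heq) j)
  · rcases lt_trichotomy i j with hij | rfl | hij
    exacts [hj.ne' (heq j hij), hi.not_gt hj, hi.not_ge (hle i hij)]

/-- `P` is reduced modulo `C`, in the sense of Ritt: it has smaller degree than every element `t` of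
`C` in the leading variable of `t`. -/
def IsReducedModulo (C : Set (MvPolynomial (Fin n) K)) (P : MvPolynomial (Fin n) K) : Prop :=
  ∀ t ∈ C, ∀ j : Fin n, leadVar t = j → degreeOf j P < degreeOf j t

theorem exists_pseudoRemainder (C : Set (MvPolynomial (Fin n) K)) (P : MvPolynomial (Fin n) K) :
    ∃ h ∈ Submonoid.closure (initial '' C), ∃ R, h * P - R ∈ Ideal.span C ∧
      IsReducedModulo C R := by
  induction hd : toColex (fun i => degreeOf i P) using WellFoundedLT.induction generalizing P with
  | _ d ih =>
  by_cases hred : IsReducedModulo C P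
  · exact ⟨1, one_mem _, P, by simp, hred⟩
  simp only [IsReducedModulo, not_forall, not_lt] at hred
  obtain ⟨t, ht, j, htj, hle⟩ := hred
  obtain ⟨Q, hQ, hlt, hQle⟩ := exists_degreeOf_lt_of_degreeOf_le htj hle
  have hdQ : toColex (fun i => degreeOf i Q) < d := hd ▸ toColex_lt_toColex hlt hQle
  obtain ⟨h, hh, R, hR, hRred⟩ := ih _ hdQ Q rfl
  refine ⟨h * initial t, mul_mem hh (Submonoid.subset_closure ⟨t, ht, rfl⟩), R, ?_, hRred⟩
  have hsplit : h * initial t * P - R = h * (initial t * P - Q) + (h * Q - R) := by ring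
  rw [hsplit]
  exact add_mem (Ideal.mul_mem_left _ _ (Ideal.span_mono (Set.singleton_subset_iff.2 ht) hQ)) hR

/-! ### Extended ideals -/

/-- `I` contains the coefficients of its elements with respect to `X j`, i.e. it is extended from
the polynomial ring in the other variables. -/
def IsExtendedIn (j : Fin n) (I : Ideal (MvPolynomial (Fin n) K)) : Prop :=
  ∀ P ∈ I, ∀ k, coeffIn j k P ∈ I

theorem isExtendedIn_span {S : Set (MvPolynomial (Fin n) K)} (hS : ∀ P ∈ S, degreeOf j P = 0) :
    IsExtendedIn j (Ideal.span S) := by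
  intro P hP k
  rw [← coeff_toPoly]
  induction hP using Submodule.span_induction generalizing k with
  | mem P hP =>
    rw [toPoly_eq_C (hS P hP), Polynomial.coeff_C]
    split_ifs
    exacts [Ideal.subset_span hP, zero_mem _]
  | zero => simp
  | add P Q _ _ hP hQ =>
    rw [map_add, Polynomial.coeff_add]
    exact add_mem (hP k) (hQ k)
  | smul A P _ hP =>
    rw [smul_eq_mul, map_mul, Polynomial.coeff_mul]
    exact Ideal.sum_mem _ fun _ _ => Ideal.mul_mem_left _ _ (hP _)

theorem isExtendedIn_saturation {I : Ideal (MvPolynomial (Fin n) K)} (hI : IsExtendedIn j I)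
    {J : MvPolynomial (Fin n) K} (hJ : degreeOf j J = 0) : IsExtendedIn j (saturation I J) := by
  rintro P ⟨i, hi⟩ k
  refine ⟨i, ?_⟩
  have hk := hI _ hi k
  rwa [← coeff_toPoly, map_mul, map_pow, toPoly_eq_C hJ, ← map_pow, Polynomial.coeff_mul_C,
    coeff_toPoly] at hk

theorem isExtendedIn_sat (hT : ∀ P ∈ T, leadVar P < j) : IsExtendedIn j (sat T) := by
  have hdeg : ∀ P ∈ T, degreeOf j P = 0 := fun P hP => degreeOf_eq_zero_of_leadVar_lt (hT P hP)
  rw [sat_eq_saturation]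
  refine isExtendedIn_saturation (isExtendedIn_span hdeg)
    (Finset.prod_induction _ (degreeOf j · = 0) ?_ ?_ ?_)
  · exact fun P Q hP hQ => Nat.le_zero.1 ((degreeOf_mul_le _ _ _).trans (by rw [hP, hQ]))
  · exact degreeOf_one _
  · exact fun P hP => Nat.le_zero.1 (hdeg P hP ▸ degreeOf_initial_le j P)

theorem IsExtendedIn.map_toPoly_eq_zero_iff {I : Ideal (MvPolynomial (Fin n) K)}
    (hI : IsExtendedIn j I) : (toPoly j P).map (Ideal.Quotient.mk I) = 0 ↔ P ∈ I := by
  simp only [Polynomial.ext_iff, Polynomial.coeff_map, coeff_toPoly, Polynomial.coeff_zero,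
    Ideal.Quotient.eq_zero_iff_mem]
  exact ⟨mem_of_coeffIn_mem j, hI P⟩

theorem IsExtendedIn.mem_of_mem_sup_span {I : Ideal (MvPolynomial (Fin n) K)}
    (hI : IsExtendedIn j I) (ht : leadVar t = j) (hreg : initial t ∈ regularElements I)
    (hP : P ∈ I ⊔ Ideal.span {t}) (hd : degreeOf j P < degreeOf j t) : P ∈ I := by
  obtain ⟨a, ha, b, hb, rfl⟩ := Submodule.mem_sup.1 hP
  obtain ⟨q, rfl⟩ := Ideal.mem_span_singleton'.1 hb
  refine add_mem ha (I.mul_mem_right _ ?_)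
  by_contra hq
  set f := fun p => (toPoly j p).map (Ideal.Quotient.mk I) with hf
  have hfq : f q ≠ 0 := hI.map_toPoly_eq_zero_iff.not.2 hq
  have : Nontrivial (MvPolynomial (Fin n) K ⧸ I) := Polynomial.nontrivial_iff.1 ⟨_, _, hfq⟩
  have hlc : Ideal.Quotient.mk I (toPoly j t).leadingCoeff ∈ nonZeroDivisors _ := by
    rwa [leadingCoeff_toPoly, ← initial_eq ht]
  have hlc0 := nonZeroDivisors.ne_zero hlc
  have hdeg : (f (a + q * t)).natDegree = (f q).natDegree + degreeOf j t := by
    have hfa : f a = 0 := hI.map_toPoly_eq_zero_iff.2 ha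
    have hmul : f (a + q * t) = f a + f q * f t := by simp [hf]
    rw [hmul, hfa, zero_add, Polynomial.natDegree_mul', ← natDegree_toPoly,
      Polynomial.natDegree_map_of_leadingCoeff_ne_zero _ hlc0]
    rw [Polynomial.leadingCoeff_map_of_leadingCoeff_ne_zero _ hlc0, Ne,
      mul_right_mem_nonZeroDivisors_eq_zero_iff hlc, Polynomial.leadingCoeff_eq_zero]
    exact hfq
  have hle : (f (a + q * t)).natDegree ≤ degreeOf j (a + q * t) :=
    Polynomial.natDegree_map_le.trans (natDegree_toPoly _ _).le
  lia

theorem degreeOf_mul_le_left {σ R : Type*} [CommSemiring R] {i : σ} {p q : MvPolynomial σ R}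
    (hq : degreeOf i q = 0) : degreeOf i (p * q) ≤ degreeOf i p :=
  (degreeOf_mul_le _ _ _).trans (by rw [hq, add_zero])

theorem IsExtendedIn.mem_of_mem_saturation {I : Ideal (MvPolynomial (Fin n) K)}
    (hI : IsExtendedIn j I) (ht : leadVar t = j) (hreg : initial t ∈ regularElements I)
    (hP : P ∈ saturation (I ⊔ Ideal.span {t}) (initial t)) (hd : degreeOf j P < degreeOf j t) :
    P ∈ I := by
  obtain ⟨k, hk⟩ := hP
  refine mem_regularElements_iff.1 (pow_mem hreg k) _
    (hI.mem_of_mem_sup_span ht hreg hk ((degreeOf_mul_le_left ?_).trans_lt hd))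
  exact Nat.le_zero.1 ((degreeOf_pow_le _ _ _).trans
    (by rw [degreeOf_initial_eq_zero ht le_rfl, mul_zero]))

/-- Once the initial of `t` is inverted, the quotient by `I ⊔ Ideal.span {t}` is free over the
part of the quotient by `I` that does not involve `X j`, so `f` stays regular. Pseudo-division by
`t` replaces the localization. -/
theorem IsExtendedIn.mem_regularElements_saturation_sup_span {I : Ideal (MvPolynomial (Fin n) K)}
    (hI : IsExtendedIn j I) {f : MvPolynomial (Fin n) K} (ht : leadVar t = j)
    (hf : f ∈ regularElements I) (hfj : degreeOf j f = 0) :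
    f ∈ regularElements (saturation (I ⊔ Ideal.span {t}) (initial t)) := by
  set c := initial t
  set I' := saturation I c
  set J := saturation (I ⊔ Ideal.span {t}) c
  have hI' : IsExtendedIn j I' := isExtendedIn_saturation hI (degreeOf_initial_eq_zero ht le_rfl)
  have hcJ : c ∈ regularElements J := self_mem_regularElements_saturation _ _
  have hI'J : I' ≤ J := saturation_le (le_sup_left.trans (le_saturation _ _)) hcJ
  have hJle : J ≤ saturation (I' ⊔ Ideal.span {t}) c :=
    saturation_le ((sup_le_sup_right (le_saturation _ _) _).trans (le_saturation _ _))
      (self_mem_regularElements_saturation _ _)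
  rw [mem_regularElements_iff]
  intro P hP
  obtain ⟨h, hh, R, hR, hred⟩ := exists_pseudoRemainder {t} P
  replace hR : h * P - R ∈ J := (le_sup_right.trans (le_saturation _ c)) hR
  rw [Set.image_singleton] at hh
  have hhJ : h ∈ regularElements J :=
    Submonoid.closure_le.2 (Set.singleton_subset_iff.2 hcJ) hh
  have hRf : R * f ∈ J := by
    have hsplit : R * f = h * (P * f) - (h * P - R) * f := by ring
    rw [hsplit]
    exact sub_mem (J.mul_mem_left _ hP) (J.mul_mem_right _ hR)
  have hRfI' : R * f ∈ I' := hI'.mem_of_mem_saturation ht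
    (self_mem_regularElements_saturation _ _) (hJle hRf)
    ((degreeOf_mul_le_left hfj).trans_lt (hred t rfl j ht))
  have hRJ : R ∈ J :=
    hI'J (mem_regularElements_iff.1 (mem_regularElements_saturation_of_mem hf) R hRfI')
  refine mem_regularElements_iff.1 hhJ P ?_
  rw [mul_comm, ← sub_add_cancel (h * P) R]
  exact add_mem hR hRJ

/-! ### Saturated ideals of triangular sets -/

/-- The elements of `T` are nonconstant and have distinct leading variables: `T` is a nontrivial
triangular set or empty. -/
def HasDistinctLeadVars (T : Finset (MvPolynomial (Fin n) K)) : Prop :=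
  (∀ P ∈ T, leadVar P ≠ ⊥) ∧ ∀ P ∈ T, ∀ Q ∈ T, leadVar P = leadVar Q → P = Q

theorem HasDistinctLeadVars.subset (hT : HasDistinctLeadVars T) (h : S ⊆ T) :
    HasDistinctLeadVars S :=
  ⟨fun P hP => hT.1 P (h hP), fun P hP Q hQ => hT.2 P (h hP) Q (h hQ)⟩

theorem HasDistinctLeadVars.exists_leadVar_eq (hT : HasDistinctLeadVars T) (hP : P ∈ T) :
    ∃ j : Fin n, leadVar P = j :=
  (WithBot.ne_bot_iff_exists.1 (hT.1 P hP)).imp fun _ => Eq.symm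

theorem HasDistinctLeadVars.induction [DecidableEq (MvPolynomial (Fin n) K)]
    {motive : ∀ T : Finset (MvPolynomial (Fin n) K), HasDistinctLeadVars T → Prop}
    (empty : motive ∅ (by simp [HasDistinctLeadVars]))
    (insert : ∀ (S t) (j : Fin n) (hS : HasDistinctLeadVars S)
      (hT : HasDistinctLeadVars (insert t S)), leadVar t = j → (∀ P ∈ S, leadVar P < j) →
        motive S hS → motive (insert t S) hT)
    (hT : HasDistinctLeadVars T) : motive T hT := by
  revert hT
  refine Finset.induction_on_max_value leadVar T (fun _ => empty) fun t S htS hmax ih hT => ?_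
  obtain ⟨j, hj⟩ := hT.exists_leadVar_eq (Finset.mem_insert_self t S)
  refine insert S t j (hT.subset (Finset.subset_insert t S)) hT hj (fun P hP => ?_) (ih _)
  refine hj ▸ (hmax P hP).lt_of_ne fun heq => htS ?_
  exact hT.2 P (Finset.mem_insert_of_mem hP) t (Finset.mem_insert_self t S) heq ▸ hP

theorem sat_insert [DecidableEq (MvPolynomial (Fin n) K)] (ht : leadVar t = j)
    (hS : ∀ P ∈ S, leadVar P < j) :
    sat (insert t S) = saturation (sat S ⊔ Ideal.span {t}) (initial t) := by
  apply le_antisymm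
  · refine sat_le ?_ ?_ <;> rw [Finset.forall_mem_insert]
    · exact ⟨le_saturation _ _ (Ideal.mem_sup_right (Ideal.mem_span_singleton_self t)),
        fun P hP => le_saturation _ _ (Ideal.mem_sup_left (mem_sat_of_mem hP))⟩
    · refine ⟨self_mem_regularElements_saturation _ _, fun P hP => ?_⟩
      exact (isExtendedIn_sat hS).mem_regularElements_saturation_sup_span ht
        (initial_mem_regularElements_sat hP)
        (Nat.le_zero.1 (degreeOf_eq_zero_of_leadVar_lt (hS P hP) ▸ degreeOf_initial_le j P))
  · have ht_mem := Finset.mem_insert_self t S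
    refine saturation_le (sup_le (sat_mono (Finset.subset_insert t S)) ?_)
      (initial_mem_regularElements_sat ht_mem)
    exact (Ideal.span_singleton_le_iff_mem _).2 (mem_sat_of_mem ht_mem)

/-- The parameters of `T`: the variables that are not the leading variable of an element. -/
def params (T : Finset (MvPolynomial (Fin n) K)) : Set (Fin n) := {i | ∀ P ∈ T, leadVar P ≠ i}

theorem notMem_params_iff : i ∉ params T ↔ ∃ P ∈ T, leadVar P = i := by
  simp [params]

theorem params_anti (h : S ⊆ T) : params T ⊆ params S :=
  fun _ hi P hP => hi P (h hP)

theorem variableOrderingCondition_iff : VariableOrderingCondition T ↔ IsLowerSet (params T) := by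
  refine ⟨fun h i j hji hi => ?_, fun h i j hi ⟨P, hP, hPj⟩ => ?_⟩
  · by_contra hj
    exact (h i j hi (notMem_params_iff.1 hj)).not_ge hji
  · exact lt_of_not_ge fun hji => h hji hi P hP hPj

theorem degreeOf_eq_zero_of_mem_supported {σ R : Type*} [CommSemiring R] {U : Set σ}
    {p : MvPolynomial σ R} {i : σ} (hp : p ∈ supported R U) (hi : i ∉ U) : degreeOf i p = 0 :=
  not_ne_iff.1 fun h => hi (mem_supported.1 hp (mem_vars_iff_degreeOf_ne_zero.2 h))

theorem HasDistinctLeadVars.mem_regularElements_sat (hT : HasDistinctLeadVars T)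
    {f : MvPolynomial (Fin n) K} (hf : f ∈ supported K (params T)) (h0 : f ≠ 0) :
    f ∈ regularElements (sat T) := by
  classical
  induction hT using HasDistinctLeadVars.induction with
  | empty =>
    rw [sat_empty, mem_regularElements_iff]
    exact fun a ha => (mul_eq_zero.1 ha).resolve_right h0
  | insert S t j _ _ ht hS ih =>
    rw [sat_insert ht hS]
    refine (isExtendedIn_sat hS).mem_regularElements_saturation_sup_span ht
      (ih (supported_mono (params_anti (Finset.subset_insert t S)) hf))
      (degreeOf_eq_zero_of_mem_supported hf ?_)
    exact notMem_params_iff.2 ⟨t, Finset.mem_insert_self t S, ht⟩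

theorem HasDistinctLeadVars.mem_sat_filter_of_isReducedModulo (hT : HasDistinctLeadVars T)
    (hreg : ∀ t ∈ T, initial t ∈ regularElements (sat {s ∈ T | leadVar s < leadVar t}))
    (hP : P ∈ sat T) {a : WithBot (Fin n)} (hred : IsReducedModulo {t ∈ T | a ≤ leadVar t} P) :
    P ∈ sat {t ∈ T | leadVar t < a} := by
  classical
  induction hT using HasDistinctLeadVars.induction with
  | empty => simpa using hP
  | insert S t j _ _ ht hS ih =>
    have hSt : ∀ s ∈ S, leadVar s < leadVar t := fun s hs => ht ▸ hS s hs
    rw [Finset.forall_mem_insert] at hreg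
    by_cases hta : leadVar t < a
    · rwa [Finset.filter_true_of_mem]
      exact Finset.forall_mem_insert _ _ _ |>.2 ⟨hta, fun s hs => (hSt s hs).trans hta⟩
    rw [Finset.filter_insert, if_neg (lt_irrefl _), Finset.filter_true_of_mem hSt] at hreg
    have hPS : P ∈ sat S := (isExtendedIn_sat hS).mem_of_mem_saturation ht hreg.1
      (sat_insert ht hS ▸ hP) (hred t ⟨Finset.mem_insert_self t S, not_lt.1 hta⟩ j ht)
    rw [Finset.filter_insert, if_neg hta]
    refine ih (fun s hs => ?_) hPS fun s hs => hred s ⟨Finset.mem_insert_of_mem hs.1, hs.2⟩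
    have hs' := hreg.2 s hs
    rwa [Finset.filter_insert, if_neg (hSt s hs).not_gt] at hs'

/-! ### Reduced polynomials modulo regular sets -/

theorem IsRegularSet.hasDistinctLeadVars (hT : IsRegularSet T) : HasDistinctLeadVars T :=
  hT.1.2

theorem IsRegularSet.mem_sat_filter_of_isReducedModulo (hT : IsRegularSet T) (hP : P ∈ sat T)
    {a : WithBot (Fin n)} (hred : IsReducedModulo {t ∈ T | a ≤ leadVar t} P) :
    P ∈ sat {t ∈ T | leadVar t < a} :=
  hT.hasDistinctLeadVars.mem_sat_filter_of_isReducedModulo (fun t ht => (hT.2 t ht).2) hP hred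

theorem IsRegularSet.eq_zero_of_isReducedModulo (hT : IsRegularSet T) (hP : P ∈ sat T)
    (hred : IsReducedModulo T P) : P = 0 := by
  have h := hT.mem_sat_filter_of_isReducedModulo hP (a := ⊥) fun t ht => hred t ht.1
  simpa [sat_empty] using h

theorem isReducedModulo_of_mem_supported_params (hP : P ∈ supported K (params T)) :
    IsReducedModulo T P := by
  intro t ht j htj
  rw [degreeOf_eq_zero_of_mem_supported hP (notMem_params_iff.2 ⟨t, ht, htj⟩)]
  exact Nat.pos_of_ne_zero (leadVar_eq_coe_iff.1 htj).1

theorem IsRegularSet.eq_zero_of_mem_supported_params (hT : IsRegularSet T) (hP : P ∈ sat T)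
    (hpar : P ∈ supported K (params T)) : P = 0 :=
  hT.eq_zero_of_isReducedModulo hP (isReducedModulo_of_mem_supported_params hpar)

theorem IsRegularSet.sat_ne_top (hT : IsRegularSet T) : sat T ≠ ⊤ := fun h =>
  one_ne_zero (hT.eq_zero_of_mem_supported_params (h ▸ Submodule.mem_top) (one_mem _))

theorem IsRegularSet.initial_mem_sat (hT : IsRegularSet T) (ht : t ∈ T) (htj : leadVar t = j)
    (hP : P ∈ sat T) (hPj : leadVar P = j) (hd : degreeOf j P < degreeOf j t) :
    initial P ∈ sat T := by
  have hred : IsReducedModulo {s ∈ T | (j : WithBot (Fin n)) ≤ leadVar s} P := by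
    rintro s ⟨hs, hjs⟩ i hi
    rcases (WithBot.coe_le_coe.1 (hi ▸ hjs)).eq_or_lt with rfl | hlt
    · rwa [hT.hasDistinctLeadVars.2 s hs t ht (hi.trans htj.symm)]
    · rw [(leadVar_eq_coe_iff.1 hPj).2 i hlt]
      exact Nat.pos_of_ne_zero (leadVar_eq_coe_iff.1 hi).1
  have hPlow := hT.mem_sat_filter_of_isReducedModulo hP hred
  rw [initial_eq hPj]
  exact sat_mono (Finset.filter_subset _ _)
    (isExtendedIn_sat (fun s hs => (Finset.mem_filter.1 hs).2) P hPlow _)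

/-! ### Algebraicity over the parameters -/

theorem exists_isIntegral_smul_coeff {k A : Type*} [CommRing k] [IsDomain k] [CommRing A]
    [Algebra k A] {p : Polynomial A} (hp : ∀ i, IsAlgebraic k (p.coeff i)) :
    ∃ y : k, y ≠ 0 ∧ ∀ i, IsIntegral k (y • p.coeff i) := by
  choose r hr0 hr using fun i => (hp i).exists_integral_multiple
  refine ⟨∏ i ∈ p.support, r i, Finset.prod_ne_zero_iff.2 fun i _ => hr0 i, fun i => ?_⟩
  by_cases hi : i ∈ p.support
  · rw [← Finset.prod_erase_mul _ _ hi, mul_smul]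
    exact (hr i).smul _
  · rw [Polynomial.notMem_support_iff.1 hi, smul_zero]
    exact isIntegral_zero

theorem isAlgebraic_of_eval_eq_zero {k A : Type*} [CommRing k] [IsDomain k] [CommRing A]
    [Algebra k A] {x : A} {p : Polynomial A} (hp : ∀ i, IsAlgebraic k (p.coeff i))
    (hlc : p.leadingCoeff ∈ nonZeroDivisors A) (hx : p.eval x = 0) : IsAlgebraic k x := by
  by_cases hinj : Function.Injective (algebraMap k A)
  swap
  · exact (Algebra.isAlgebraic_of_not_injective hinj).1 x
  obtain ⟨y, hy0, hy⟩ := exists_isIntegral_smul_coeff hp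
  have hylc : (y • p).leadingCoeff = y • p.leadingCoeff := by
    have hne : algebraMap k A y * p.leadingCoeff ≠ 0 := fun h =>
      (map_ne_zero_iff _ hinj).2 hy0 ((mul_right_mem_nonZeroDivisors_eq_zero_iff hlc).1 h)
    rw [← algebraMap_smul A y p, Polynomial.smul_eq_C_mul, Polynomial.leadingCoeff_mul',
      Polynomial.leadingCoeff_C, Algebra.smul_def]
    rwa [Polynomial.leadingCoeff_C]
  obtain ⟨q, hq⟩ : ∃ q : Polynomial (integralClosure k A), q.map (algebraMap _ A) = y • p :=
    (Polynomial.lifts_iff_coeff_lifts _).2 fun i => ⟨⟨_, hy i⟩, Polynomial.coeff_smul y p i⟩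
  have hqx : Polynomial.aeval x q = 0 := by
    rw [← Polynomial.eval_map_algebraMap, hq, Polynomial.eval_smul, hx, smul_zero]
  have hqlc : algebraMap (integralClosure k A) A q.leadingCoeff = y • p.leadingCoeff := by
    rw [← hylc, ← hq, Polynomial.leadingCoeff_map_of_injective Subtype.val_injective]
  have hint : IsIntegral k (y • (p.leadingCoeff * x)) := by
    rw [← smul_mul_assoc, ← hqlc, ← Algebra.smul_def]
    exact isIntegral_trans _ (isIntegral_leadingCoeff_smul q x hqx)
  exact .of_mul hlc (hp _) (hint.isAlgebraic.of_smul (mem_nonZeroDivisors_of_ne_zero hy0))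

theorem isAlgebraic_mk_of_vars {σ : Type*} {U : Set σ} {I : Ideal (MvPolynomial σ K)}
    {p : MvPolynomial σ K}
    (h : ∀ i ∈ p.vars, IsAlgebraic (supported K U) (Ideal.Quotient.mk I (X i))) :
    IsAlgebraic (supported K U) (Ideal.Quotient.mk I p) := by
  have hle : supported K (p.vars : Set σ) ≤
      ((Subalgebra.algebraicClosure (supported K U)
        (MvPolynomial σ K ⧸ I)).restrictScalars K).comap (Ideal.Quotient.mkₐ K I) := by
    rw [supported_eq_adjoin_X, Algebra.adjoin_le_iff]
    rintro _ ⟨i, hi, rfl⟩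
    exact h i hi
  exact hle (mem_supported_vars p)

theorem isAlgebraic_mk_sat_X (T : Finset (MvPolynomial (Fin n) K)) (j : Fin n) :
    IsAlgebraic (supported K (params T)) (Ideal.Quotient.mk (sat T) (X j)) := by
  induction j using WellFoundedLT.induction with
  | _ j ih =>
  by_cases hj : j ∈ params T
  · exact isAlgebraic_algebraMap (⟨X j, X_mem_supported.2 hj⟩ : supported K (params T))
  obtain ⟨t, ht, htj⟩ := notMem_params_iff.1 hj
  cases subsingleton_or_nontrivial (MvPolynomial (Fin n) K ⧸ sat T) with
  | inl _ =>
    rw [Subsingleton.elim (Ideal.Quotient.mk (sat T) (X j)) 0]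
    exact isAlgebraic_zero
  | inr _ =>
  have hreg : Ideal.Quotient.mk (sat T) (toPoly j t).leadingCoeff ∈ nonZeroDivisors _ := by
    rw [leadingCoeff_toPoly, ← initial_eq htj]
    exact initial_mem_regularElements_sat ht
  refine isAlgebraic_of_eval_eq_zero (p := (toPoly j t).map (Ideal.Quotient.mk (sat T)))
    (fun k => ?_) ?_ ?_
  · rw [Polynomial.coeff_map, coeff_toPoly]
    refine isAlgebraic_mk_of_vars fun i hi => ih i (not_le.1 fun hji => ?_)
    refine mem_vars_iff_degreeOf_ne_zero.1 hi ?_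
    rcases hji.eq_or_lt with rfl | hji
    · exact degreeOf_self_coeffIn _ _ _
    · exact Nat.le_zero.1 ((leadVar_eq_coe_iff.1 htj).2 i hji ▸ degreeOf_coeffIn_le i j k t)
  · rwa [Polynomial.leadingCoeff_map_of_leadingCoeff_ne_zero _ (nonZeroDivisors.ne_zero hreg)]
  · rw [Polynomial.eval_map_apply, eval_toPoly]
    exact Ideal.Quotient.eq_zero_iff_mem.2 (mem_sat_of_mem ht)

theorem mk_aeval {R A : Type*} [CommRing R] [CommRing A] [Algebra R A] (I : Ideal A) (a : A)
    (p : Polynomial R) :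
    Ideal.Quotient.mk I (Polynomial.aeval a p) = Polynomial.aeval (Ideal.Quotient.mk I a) p :=
  (Polynomial.aeval_algHom_apply (Ideal.Quotient.mkₐ R I) a p).symm

theorem aeval_mem_supported {σ R : Type*} [CommRing R] {U W : Set σ} (hUW : U ⊆ W)
    {c : MvPolynomial σ R} (hc : c ∈ supported R W) (p : Polynomial (supported R U)) :
    Polynomial.aeval c p ∈ supported R W := by
  rw [Polynomial.aeval_eq_sum_range]
  refine sum_mem fun i _ => ?_
  rw [Algebra.smul_def]
  exact mul_mem (supported_mono hUW (p.coeff i).2) (pow_mem hc i)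

theorem exists_mul_sub_mem_sat {c : MvPolynomial (Fin n) K} (hc : c ∈ regularElements (sat T))
    {W : Set (Fin n)} (hW : params T ⊆ W) (hcW : c ∈ supported K W) :
    ∃ c' ∈ supported K W, ∃ h ∈ supported K (params T), h ≠ 0 ∧ c * c' - h ∈ sat T := by
  have halg : IsAlgebraic (supported K (params T)) (Ideal.Quotient.mk (sat T) c) :=
    isAlgebraic_mk_of_vars fun i _ => isAlgebraic_mk_sat_X T i
  obtain ⟨s, hs, h, h0, hcs⟩ := halg.exists_nonzero_eq_adjoin_mul hc
  rw [Algebra.adjoin_singleton_eq_range_aeval] at hs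
  obtain ⟨p, rfl⟩ := hs
  refine ⟨Polynomial.aeval c p, aeval_mem_supported hW hcW p, h, h.2,
    fun h' => h0 (Subtype.ext h'), ?_⟩
  rw [← Ideal.Quotient.eq_zero_iff_mem, map_sub, map_mul, sub_eq_zero, mk_aeval]
  exact hcs

theorem exists_mem_sat_supported_insert (hj : j ∉ params T) :
    ∃ g ∈ sat T, g ≠ 0 ∧ g ∈ supported K (insert j (params T)) := by
  obtain ⟨p, hp0, hp⟩ := isAlgebraic_mk_sat_X T j
  refine ⟨Polynomial.aeval (X j) p, ?_, fun h0 => transcendental_supported_X K hj ⟨p, hp0, h0⟩,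
    aeval_mem_supported (Set.subset_insert _ _) (X_mem_supported.2 (Set.mem_insert _ _)) p⟩
  rw [← Ideal.Quotient.eq_zero_iff_mem, mk_aeval, hp]

/-! ### Leading monomials in the lexicographic order -/

theorem lexOrder_degree_apply_le (i : Fin n) (P : MvPolynomial (Fin n) K) :
    (lexOrder n).degree P i ≤ degreeOf i P := by
  by_cases h0 : P = 0
  · simp [h0]
  · exact monomial_le_degreeOf i ((lexOrder n).degree_mem_support h0)

theorem lexOrder_degree_mul_X_pow_add {d : ℕ} {h r : MvPolynomial (Fin n) K} (h0 : h ≠ 0)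
    (hr : ∀ i, j < i → degreeOf i r = 0) (hrd : degreeOf j r < d)
    (hh : ∀ i, j < i → degreeOf i h = 0) :
    (lexOrder n).degree (h * X j ^ d + r) = (lexOrder n).degree h + Finsupp.single j d := by
  classical
  have hmul : (lexOrder n).degree (h * X j ^ d) =
      (lexOrder n).degree h + Finsupp.single j d := by
    rw [X_pow_eq_monomial, MonomialOrder.degree_mul h0 (by simp), MonomialOrder.degree_monomial,
      if_neg one_ne_zero]
  rw [MonomialOrder.degree_add_of_lt, hmul]
  rw [hmul, lexOrder_lt_iff]
  refine ⟨j, fun i hi => ?_, ?_⟩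
  · have hri := hr i hi ▸ lexOrder_degree_apply_le i r
    have hhi := hh i hi ▸ lexOrder_degree_apply_le i h
    rw [Finsupp.add_apply, Finsupp.single_eq_of_ne hi.ne', Nat.le_zero.1 hri, Nat.le_zero.1 hhi,
      add_zero]
  · rw [Finsupp.add_apply, Finsupp.single_eq_same]
    exact ((lexOrder_degree_apply_le j r).trans_lt hrd).trans_le (Nat.le_add_left _ _)

/-- `P` without its leading term with respect to its leading variable `X j`. -/
def tail (j : Fin n) (P : MvPolynomial (Fin n) K) : MvPolynomial (Fin n) K :=
  P - initial P * X j ^ degreeOf j P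

theorem degreeOf_tail_lt (hP : leadVar P = j) : degreeOf j (tail j P) < degreeOf j P := by
  have herase : toPoly j (tail j P) = (toPoly j P).eraseLead := by
    rw [← Polynomial.self_sub_C_mul_X_pow, leadingCoeff_toPoly, natDegree_toPoly, tail, map_sub,
      map_mul, map_pow, toPoly_X, toPoly_eq_C (degreeOf_initial_eq_zero hP le_rfl), initial_eq hP]
  rw [← natDegree_toPoly, ← natDegree_toPoly, herase]
  refine (Polynomial.eraseLead_natDegree_le _).trans_lt (Nat.sub_lt ?_ one_pos)
  rw [natDegree_toPoly]
  exact Nat.pos_of_ne_zero (leadVar_eq_coe_iff.1 hP).1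

theorem degreeOf_tail_eq_zero (hP : leadVar P = j) (hij : j < i) : degreeOf i (tail j P) = 0 := by
  refine Nat.le_zero.1 ((degreeOf_sub_le _ _ _).trans (max_le ?_ ?_))
  · exact ((leadVar_eq_coe_iff.1 hP).2 i hij).le
  · rw [degreeOf_mul_X_pow_of_ne _ hij.ne', degreeOf_initial_eq_zero hP hij.le]

theorem lexOrder_degree_eq (hP : leadVar P = j) :
    (lexOrder n).degree P =
      (lexOrder n).degree (initial P) + Finsupp.single j (degreeOf j P) := by
  conv_lhs => rw [← add_sub_cancel (initial P * X j ^ degreeOf j P) P]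
  exact lexOrder_degree_mul_X_pow_add (initial_ne_zero hP) (fun i => degreeOf_tail_eq_zero hP)
    (degreeOf_tail_lt hP) fun i hi => degreeOf_initial_eq_zero hP hi.le

theorem lexOrder_degree_apply_eq (hP : leadVar P = j) : (lexOrder n).degree P j = degreeOf j P := by
  have hini := degreeOf_initial_eq_zero hP le_rfl ▸ lexOrder_degree_apply_le j (initial P)
  rw [lexOrder_degree_eq hP, Finsupp.add_apply, Finsupp.single_eq_same, Nat.le_zero.1 hini,
    zero_add]

theorem mem_supported_of_lexOrder_degree {U : Set (Fin n)} (hU : IsLowerSet U)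
    (hP : ∀ i ∉ U, (lexOrder n).degree P i = 0) : P ∈ supported K U := by
  rw [mem_supported]
  intro i hi
  by_contra hiU
  obtain ⟨s, hs, hsi⟩ := mem_vars_iff_mem_support i |>.1 hi
  refine Finsupp.mem_support_iff.1 hsi ?_
  rcases eq_or_lt_of_le ((lexOrder n).le_degree hs) with heq | hlt
  · rw [(lexOrder n).toSyn.injective heq, hP i hiU]
  · obtain ⟨k, hk, hsk⟩ := lexOrder_lt_iff.1 hlt
    have hkU : k ∈ U := by
      by_contra hkU
      rw [hP k hkU] at hsk
      exact Nat.not_lt_zero _ hsk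
    rw [hk i (lt_of_not_ge fun hik => hiU (hU hik hkU)), hP i hiU]

theorem leadVar_eq_of_lexOrder_degree (hj : (lexOrder n).degree P j ≠ 0)
    (hlt : ∀ i, j < i → (lexOrder n).degree P i = 0) : leadVar P = j := by
  refine leadVar_eq_coe_iff.2 ⟨fun h => hj ?_, fun i hi => ?_⟩
  · exact Nat.le_zero.1 (h ▸ lexOrder_degree_apply_le j P)
  · exact degreeOf_eq_zero_of_mem_supported (mem_supported_of_lexOrder_degree (isLowerSet_Iic j)
      fun k hk => hlt k (not_le.1 hk)) hi.not_ge

open Classical in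
theorem filter_notMem_le_of_lexOrder_le {U : Set (Fin n)} (hU : IsLowerSet U) {a b : Fin n →₀ ℕ}
    (hab : a ≼[lexOrder n] b) :
    a.filter (· ∉ U) ≼[lexOrder n] b.filter (· ∉ U) := by
  rcases eq_or_lt_of_le hab with heq | hlt
  · rw [(lexOrder n).toSyn.injective heq]
  obtain ⟨k, hk, hlt⟩ := lexOrder_lt_iff.1 hlt
  by_cases hkU : k ∈ U
  · have heq : a.filter (· ∉ U) = b.filter (· ∉ U) := by
      ext i
      simp only [Finsupp.filter_apply]
      exact ite_congr rfl (fun hi => hk i (lt_of_not_ge fun hik => hi (hU hik hkU))) fun _ => rfl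
    rw [heq]
  · refine (lexOrder_lt_iff.2 ⟨k, fun i hi => ?_, ?_⟩).le
    · simp only [Finsupp.filter_apply, hk i hi]
    · simpa only [Finsupp.filter_apply, if_pos hkU] using hlt

/-! ### The reduced Gröbner basis of a saturated ideal -/

theorem IsReducedGroebnerBasis.degree_eq_of_degree_le {σ : Type*} {m : MonomialOrder σ}
    {I : Ideal (MvPolynomial σ K)} {G : Finset (MvPolynomial σ K)}
    (hG : IsReducedGroebnerBasis m I G) {g p : MvPolynomial σ K} (hg : g ∈ G) (hp : p ∈ I)
    (h0 : p ≠ 0) (hle : m.degree p ≤ m.degree g) : m.degree p = m.degree g := by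
  obtain ⟨q, hq, hqp⟩ := hG.exists_degree_le hp h0
  suffices q = g from le_antisymm hle (this ▸ hqp)
  by_contra hqg
  exact hG.2.2 g hg q hq hqg _ (m.degree_mem_support (hG.2.1 g hg).ne_zero) (hqp.trans hle)

theorem IsReducedGroebnerBasis.eq_of_degree_eq {σ : Type*} {m : MonomialOrder σ}
    {I : Ideal (MvPolynomial σ K)} {G : Finset (MvPolynomial σ K)}
    (hG : IsReducedGroebnerBasis m I G) {g h : MvPolynomial σ K} (hg : g ∈ G) (hh : h ∈ G)
    (heq : m.degree g = m.degree h) : g = h := by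
  by_contra hne
  exact hG.2.2 h hh g hg hne _ (m.degree_mem_support (hG.2.1 h hh).ne_zero) heq.le

section WCharSet

variable {I : Ideal (MvPolynomial (Fin n) K)}

theorem mem_of_mem_wCharSet (hP : P ∈ wCharSet I) : P ∈ I :=
  (reducedGroebnerBasis_spec (lexOrder n) I).1.1 P (Finset.mem_filter.1 hP).1

theorem ne_zero_of_mem_wCharSet (hP : P ∈ wCharSet I) : P ≠ 0 :=
  ((reducedGroebnerBasis_spec (lexOrder n) I).2.1 P (Finset.mem_filter.1 hP).1).ne_zero

theorem exists_mem_wCharSet (hQ : Q ∈ reducedGroebnerBasis (lexOrder n) I) :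
    ∃ P ∈ wCharSet I, leadVar P = leadVar Q := by
  classical
  obtain ⟨P, hP, hmin⟩ := Finset.exists_min_image
    {P ∈ reducedGroebnerBasis (lexOrder n) I | leadVar P = leadVar Q}
    (fun P => (lexOrder n).toSyn ((lexOrder n).degree P)) ⟨Q, Finset.mem_filter.2 ⟨hQ, rfl⟩⟩
  rw [Finset.mem_filter] at hP
  refine ⟨P, Finset.mem_filter.2 ⟨hP.1, fun R hR hRP => ?_⟩, hP.2⟩
  exact hmin R (Finset.mem_filter.2 ⟨hR, hRP.trans hP.2⟩)

theorem eq_of_mem_wCharSet (hP : P ∈ wCharSet I) (hQ : Q ∈ wCharSet I)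
    (h : leadVar P = leadVar Q) : P = Q := by
  obtain ⟨hPG, hPmin⟩ := Finset.mem_filter.1 hP
  obtain ⟨hQG, hQmin⟩ := Finset.mem_filter.1 hQ
  exact (reducedGroebnerBasis_spec (lexOrder n) I).eq_of_degree_eq hPG hQG
    ((lexOrder n).toSyn.injective (le_antisymm (hPmin Q hQG h.symm) (hQmin P hPG h)))

end WCharSet

theorem exists_mem_sat_lexOrder_degree (hlow : IsLowerSet (params T)) (ht : t ∈ T)
    (htj : leadVar t = j) :
    ∃ M ∈ sat T, M ≠ 0 ∧ ∃ h ∈ supported K (params T),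
      (lexOrder n).degree M = (lexOrder n).degree h + Finsupp.single j (degreeOf j t) := by
  have hjpar : j ∉ params T := notMem_params_iff.2 ⟨t, ht, htj⟩
  have hpar : params T ⊆ Set.Iio j := fun i hi => lt_of_not_ge fun hji => hjpar (hlow hji hi)
  have hini : initial t ∈ supported K (Set.Iio j) := mem_supported.2 fun i hi => not_le.1 fun hji =>
    mem_vars_iff_degreeOf_ne_zero.1 hi (degreeOf_initial_eq_zero htj hji)
  obtain ⟨c, hc, h, hh, h0, hch⟩ :=
    exists_mul_sub_mem_sat (initial_mem_regularElements_sat ht) hpar hini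
  have hdeg : (lexOrder n).degree (h * X j ^ degreeOf j t + tail j t * c) =
      (lexOrder n).degree h + Finsupp.single j (degreeOf j t) := by
    refine lexOrder_degree_mul_X_pow_add h0 (fun i hi => ?_) ?_ fun i hi => ?_
    · refine Nat.le_zero.1 ((degreeOf_mul_le_left ?_).trans (degreeOf_tail_eq_zero htj hi).le)
      exact degreeOf_eq_zero_of_mem_supported hc hi.not_gt
    · refine (degreeOf_mul_le_left ?_).trans_lt (degreeOf_tail_lt htj)
      exact degreeOf_eq_zero_of_mem_supported hc (lt_irrefl j)
    · exact degreeOf_eq_zero_of_mem_supported hh fun hi' => (hpar hi').not_gt hi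
  refine ⟨_, ?_, fun hM => ?_, h, hh, hdeg⟩
  · have hsplit : h * X j ^ degreeOf j t + tail j t * c =
        c * t - X j ^ degreeOf j t * (initial t * c - h) := by
      rw [tail]
      ring
    rw [hsplit]
    exact sub_mem (Ideal.mul_mem_left _ _ (mem_sat_of_mem ht)) (Ideal.mul_mem_left _ _ hch)
  · rw [hM, MonomialOrder.degree_zero] at hdeg
    have hj := DFunLike.congr_fun hdeg j
    rw [Finsupp.add_apply, Finsupp.single_eq_same, Finsupp.zero_apply] at hj
    have := Nat.pos_of_ne_zero (leadVar_eq_coe_iff.1 htj).1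
    lia

theorem IsRegularSet.degreeOf_le_degreeOf_of_mem_reducedGroebnerBasis (hT : IsRegularSet T)
    {g : MvPolynomial (Fin n) K} (ht : t ∈ T) (htj : leadVar t = j)
    (hg : g ∈ reducedGroebnerBasis (lexOrder n) (sat T)) (hgj : leadVar g = j) :
    degreeOf j t ≤ degreeOf j g := by
  by_contra! hlt
  have hG := reducedGroebnerBasis_spec (lexOrder n) (sat T)
  have hini : initial g ∈ sat T := hT.initial_mem_sat ht htj (hG.1.1 g hg) hgj hlt
  have hle : (lexOrder n).degree (initial g) ≤ (lexOrder n).degree g :=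
    lexOrder_degree_eq hgj ▸ le_self_add
  have hdeg := hG.degree_eq_of_degree_le hg hini (initial_ne_zero hgj) hle
  have hself := lexOrder_degree_eq hgj
  rw [hdeg, left_eq_add, Finsupp.single_eq_zero] at hself
  exact (leadVar_eq_coe_iff.1 hgj).1 hself

theorem IsRegularSet.exists_mem_reducedGroebnerBasis (hT : IsRegularSet T)
    (hlow : IsLowerSet (params T)) (ht : t ∈ T) (htj : leadVar t = j) :
    ∃ g ∈ reducedGroebnerBasis (lexOrder n) (sat T), leadVar g = j ∧
      ∀ i ∉ params T, (lexOrder n).degree g i ≤ Finsupp.single j (degreeOf j t) i := by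
  have hG := reducedGroebnerBasis_spec (lexOrder n) (sat T)
  obtain ⟨M, hM, hM0, h, hh, hMdeg⟩ := exists_mem_sat_lexOrder_degree hlow ht htj
  obtain ⟨g, hg, hgM⟩ := hG.exists_degree_le hM hM0
  have hle : ∀ i ∉ params T, (lexOrder n).degree g i ≤ Finsupp.single j (degreeOf j t) i := by
    intro i hi
    have hhi := degreeOf_eq_zero_of_mem_supported hh hi ▸ lexOrder_degree_apply_le i h
    have hgi := hgM i
    rwa [hMdeg, Finsupp.add_apply, Nat.le_zero.1 hhi, zero_add] at hgi
  have hzero : ∀ i ∉ params T, i ≠ j → (lexOrder n).degree g i = 0 := fun i hi hij =>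
    Nat.le_zero.1 ((hle i hi).trans (Finsupp.single_eq_of_ne hij).le)
  refine ⟨g, hg, leadVar_eq_of_lexOrder_degree (fun hgj => ?_) fun i hi => hzero i ?_ hi.ne', hle⟩
  · refine (hG.2.1 g hg).ne_zero (hT.eq_zero_of_mem_supported_params (hG.1.1 g hg)
      (mem_supported_of_lexOrder_degree hlow fun i hi => ?_))
    rcases eq_or_ne i j with rfl | hij
    exacts [hgj, hzero i hi hij]
  · exact fun hipar => notMem_params_iff.2 ⟨t, ht, htj⟩ (hlow hi.le hipar)

/-! ### The W-characteristic set of a saturated ideal -/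

/-- By minimality, `c` is below the Gröbner basis element supplied by
`IsRegularSet.exists_mem_reducedGroebnerBasis`, and its degree in `X j` is at least that of `t`:
outside of the parameters this leaves no choice. -/
theorem IsRegularSet.lexOrder_degree_apply_eq_of_mem_wCharSet (hT : IsRegularSet T)
    (hlow : IsLowerSet (params T)) {c : MvPolynomial (Fin n) K} (ht : t ∈ T) (htj : leadVar t = j)
    (hc : c ∈ wCharSet (sat T)) (hcj : leadVar c = j) :
    ∀ i ∉ params T, (lexOrder n).degree c i = Finsupp.single j (degreeOf j t) i := by
  classical
  obtain ⟨hcG, hmin⟩ := Finset.mem_filter.1 hc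
  obtain ⟨g, hg, hgj, hgt⟩ := hT.exists_mem_reducedGroebnerBasis hlow ht htj
  have hupper : ((lexOrder n).degree c).filter (· ∉ params T) ≼[lexOrder n]
      Finsupp.single j (degreeOf j t) := by
    refine (filter_notMem_le_of_lexOrder_le hlow (hmin g hg (hgj.trans hcj.symm))).trans
      ((lexOrder n).toSyn_monotone fun i => ?_)
    rw [Finsupp.filter_apply]
    split_ifs with hi
    exacts [Nat.zero_le _, hgt i hi]
  have hlower : Finsupp.single j (degreeOf j t) ≤
      ((lexOrder n).degree c).filter (· ∉ params T) := by
    rw [Finsupp.single_le_iff, Finsupp.filter_apply, if_pos (notMem_params_iff.2 ⟨t, ht, htj⟩),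
      lexOrder_degree_apply_eq hcj]
    exact hT.degreeOf_le_degreeOf_of_mem_reducedGroebnerBasis ht htj hcG hcj
  have heq := (lexOrder n).toSyn.injective
    (le_antisymm hupper ((lexOrder n).toSyn_monotone hlower))
  intro i hi
  rw [← heq, Finsupp.filter_apply, if_pos hi]

theorem IsRegularSet.degreeOf_eq_of_mem_wCharSet (hT : IsRegularSet T)
    (hlow : IsLowerSet (params T)) {c : MvPolynomial (Fin n) K} (ht : t ∈ T) (htj : leadVar t = j)
    (hc : c ∈ wCharSet (sat T)) (hcj : leadVar c = j) : degreeOf j c = degreeOf j t := by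
  rw [← lexOrder_degree_apply_eq hcj, hT.lexOrder_degree_apply_eq_of_mem_wCharSet hlow ht htj hc hcj
    j (notMem_params_iff.2 ⟨t, ht, htj⟩), Finsupp.single_eq_same]

theorem IsRegularSet.exists_leadVar_eq_of_mem_sat (hT : IsRegularSet T)
    (hlow : IsLowerSet (params T)) (hP : P ∈ sat T) (h0 : P ≠ 0) :
    ∃ t ∈ T, ∃ j : Fin n, leadVar t = j ∧ leadVar P = j := by
  obtain ⟨i, hiP, hi⟩ : ∃ i ∈ P.vars, i ∉ params T := by
    by_contra! h
    exact h0 (hT.eq_zero_of_mem_supported_params hP (mem_supported.2 h))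
  obtain ⟨j, hj⟩ := Finset.max_of_mem hiP
  have hij : i ≤ j := Finset.le_max_of_eq hiP hj
  obtain ⟨t, ht, htj⟩ := notMem_params_iff.1 fun hjpar => hi (hlow hij hjpar)
  exact ⟨t, ht, j, htj, hj⟩

theorem IsRegularSet.exists_mem_wCharSet_leadVar_eq (hT : IsRegularSet T)
    (hlow : IsLowerSet (params T)) (ht : t ∈ T) (htj : leadVar t = j) :
    ∃ c ∈ wCharSet (sat T), leadVar c = j := by
  obtain ⟨g, hg, hgj, -⟩ := hT.exists_mem_reducedGroebnerBasis hlow ht htj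
  obtain ⟨c, hc, hcg⟩ := exists_mem_wCharSet hg
  exact ⟨c, hc, hcg.trans hgj⟩

theorem IsRegularSet.initial_mem_supported_params_of_mem_wCharSet (hT : IsRegularSet T)
    (hlow : IsLowerSet (params T)) {c : MvPolynomial (Fin n) K} (hc : c ∈ wCharSet (sat T)) :
    initial c ∈ supported K (params T) ∧ initial c ≠ 0 := by
  obtain ⟨t, ht, j, htj, hcj⟩ :=
    hT.exists_leadVar_eq_of_mem_sat hlow (mem_of_mem_wCharSet hc) (ne_zero_of_mem_wCharSet hc)
  refine ⟨mem_supported_of_lexOrder_degree hlow fun i hi => ?_, initial_ne_zero hcj⟩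
  have heq := hT.lexOrder_degree_apply_eq_of_mem_wCharSet hlow ht htj hc hcj i hi
  rwa [lexOrder_degree_eq hcj, hT.degreeOf_eq_of_mem_wCharSet hlow ht htj hc hcj,
    Finsupp.add_apply, add_eq_right] at heq

theorem IsRegularSet.hasDistinctLeadVars_wCharSet (hT : IsRegularSet T)
    (hlow : IsLowerSet (params T)) : HasDistinctLeadVars (wCharSet (sat T)) := by
  refine ⟨fun c hc => ?_, fun P hP Q hQ => eq_of_mem_wCharSet hP hQ⟩
  obtain ⟨-, -, j, -, hcj⟩ :=
    hT.exists_leadVar_eq_of_mem_sat hlow (mem_of_mem_wCharSet hc) (ne_zero_of_mem_wCharSet hc)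
  exact hcj ▸ WithBot.coe_ne_bot

theorem IsRegularSet.sat_le_sat_of_subset_wCharSet (hT : IsRegularSet T)
    (hlow : IsLowerSet (params T)) (hS : S ⊆ wCharSet (sat T)) : sat S ≤ sat T := by
  refine sat_le (fun c hc => mem_of_mem_wCharSet (hS hc)) fun c hc => ?_
  obtain ⟨hpar, h0⟩ := hT.initial_mem_supported_params_of_mem_wCharSet hlow (hS hc)
  exact hT.hasDistinctLeadVars.mem_regularElements_sat hpar h0

theorem IsRegularSet.params_subset_params_wCharSet (hT : IsRegularSet T)
    (hlow : IsLowerSet (params T)) : params T ⊆ params (wCharSet (sat T)) := by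
  intro i hi c hc hci
  obtain ⟨t, ht, j, htj, hcj⟩ :=
    hT.exists_leadVar_eq_of_mem_sat hlow (mem_of_mem_wCharSet hc) (ne_zero_of_mem_wCharSet hc)
  exact hi t ht (htj.trans (hcj.symm.trans hci))

theorem IsRegularSet.isRegularSet_wCharSet (hT : IsRegularSet T) (hlow : IsLowerSet (params T)) :
    IsRegularSet (wCharSet (sat T)) := by
  have hC := hT.hasDistinctLeadVars_wCharSet hlow
  obtain ⟨t, ht⟩ := hT.1.1
  obtain ⟨j, htj⟩ := hT.hasDistinctLeadVars.exists_leadVar_eq ht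
  obtain ⟨c₀, hc₀, -⟩ := hT.exists_mem_wCharSet_leadVar_eq hlow ht htj
  refine ⟨⟨⟨c₀, hc₀⟩, hC⟩, fun c hc => ?_⟩
  set S : Finset (MvPolynomial (Fin n) K) := {d ∈ wCharSet (sat T) | leadVar d < leadVar c}
  have hS : S ⊆ wCharSet (sat T) := Finset.filter_subset _ _
  obtain ⟨hpar, h0⟩ := hT.initial_mem_supported_params_of_mem_wCharSet hlow hc
  refine ⟨fun hmem => h0 (hT.eq_zero_of_mem_supported_params ?_ hpar), ?_⟩
  · exact hT.sat_le_sat_of_subset_wCharSet hlow hS (Ideal.Quotient.eq_zero_iff_mem.1 hmem)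
  · exact (hC.subset hS).mem_regularElements_sat (supported_mono
      ((hT.params_subset_params_wCharSet hlow).trans (params_anti hS)) hpar) h0

theorem IsRegularSet.isReducedModulo_of_wCharSet (hT : IsRegularSet T)
    (hlow : IsLowerSet (params T)) (hP : IsReducedModulo (wCharSet (sat T)) P) :
    IsReducedModulo T P := by
  intro t ht j htj
  obtain ⟨c, hc, hcj⟩ := hT.exists_mem_wCharSet_leadVar_eq hlow ht htj
  exact hT.degreeOf_eq_of_mem_wCharSet hlow ht htj hc hcj ▸ hP c hc j hcj

theorem IsRegularSet.sat_wCharSet (hT : IsRegularSet T) (hlow : IsLowerSet (params T)) :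
    sat (wCharSet (sat T)) = sat T := by
  set C := wCharSet (sat T)
  have hle : sat C ≤ sat T := hT.sat_le_sat_of_subset_wCharSet hlow subset_rfl
  refine le_antisymm hle fun P hP => ?_
  obtain ⟨h, hh, R, hR, hred⟩ := exists_pseudoRemainder (C : Set (MvPolynomial (Fin n) K)) P
  replace hR : h * P - R ∈ sat C := Ideal.span_le.2 (fun _ => mem_sat_of_mem) hR
  have hRT : R ∈ sat T := by
    simpa only [sub_sub_cancel] using sub_mem (Ideal.mul_mem_left _ h hP) (hle hR)
  have hR0 : R = 0 :=
    hT.eq_zero_of_isReducedModulo hRT (hT.isReducedModulo_of_wCharSet hlow hred)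
  have hhreg : h ∈ regularElements (sat C) := by
    refine Submonoid.closure_le.2 ?_ hh
    rintro _ ⟨c, hc, rfl⟩
    exact initial_mem_regularElements_sat hc
  rw [hR0, sub_zero, mul_comm] at hR
  exact mem_regularElements_iff.1 hhreg P hR

/-! ### Equiprojectable saturated ideals -/

theorem IsTrivialTriangularSet.sat_eq_top (hT : IsTrivialTriangularSet T) : sat T = ⊤ := by
  obtain ⟨c, hc, rfl⟩ := hT
  exact Ideal.eq_top_of_isUnit_mem _ (mem_sat_of_mem (Finset.mem_singleton_self _))
    ((isUnit_iff_ne_zero.2 hc).map C)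

theorem IsRegularSet.params_eq_of_sat_eq {T' : Finset (MvPolynomial (Fin n) K)}
    (hT' : IsRegularSet T') (hT : HasDistinctLeadVars T) (hlow : IsLowerSet (params T))
    (h : sat T = sat T') : params T' = params T := by
  have hle : params T ⊆ params T' := by
    intro j hj t ht htj
    have hpar : t ∈ supported K (params T) := mem_supported.2 fun i hi =>
      hlow (Finset.le_max_of_eq hi htj) hj
    have hreg := hT.mem_regularElements_sat hpar (ne_zero_of_leadVar_eq htj)
    rw [h, mem_regularElements_iff] at hreg
    exact hT'.sat_ne_top ((Ideal.eq_top_iff_one _).2 (hreg 1 (by simpa using mem_sat_of_mem ht)))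
  refine subset_antisymm (fun j hj => ?_) hle
  by_contra hjT
  obtain ⟨g, hg, h0, hgsupp⟩ := exists_mem_sat_supported_insert hjT
  exact h0 (hT'.eq_zero_of_mem_supported_params (h ▸ hg)
    (supported_mono (Set.insert_subset hj hle) hgsupp))

end

end TriSet

theorem corollary3p4_general {K : Type*} [Field K] {n : ℕ}
    (T : Finset (MvPolynomial (Fin n) K))
    (hT : TriSet.IsTriangularSet T ∨ TriSet.IsTrivialTriangularSet T)
    (hvar : TriSet.VariableOrderingCondition T) :
    TriSet.IsEquiprojectable (TriSet.sat T) ↔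
      TriSet.IsRegularSet (TriSet.wCharSet (TriSet.sat T)) ∧
        TriSet.sat T = TriSet.sat (TriSet.wCharSet (TriSet.sat T)) := by
  refine ⟨?_, fun h => ⟨_, h⟩⟩
  rintro ⟨T', hreg, heq⟩
  rcases hT with hT | hT
  · have hlow := TriSet.variableOrderingCondition_iff.1 hvar
    have hlow' : IsLowerSet (TriSet.params T') :=
      hreg.params_eq_of_sat_eq hT.2 hlow heq ▸ hlow
    rw [heq]
    exact ⟨hreg.isRegularSet_wCharSet hlow', (hreg.sat_wCharSet hlow').symm⟩
  · exact absurd (heq.symm.trans hT.sat_eq_top) hreg.sat_ne_top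

theorem corollary3p4 {K : Type*} [Field K] [CharZero K] {n : ℕ}
    (T : Finset (MvPolynomial (Fin n) K))
    (hT : TriSet.IsTriangularSet T ∨ TriSet.IsTrivialTriangularSet T)
    (hvar : TriSet.VariableOrderingCondition T) :
    TriSet.IsEquiprojectable (TriSet.sat T) ↔
      TriSet.IsRegularSet (TriSet.wCharSet (TriSet.sat T)) ∧
        TriSet.sat T = TriSet.sat (TriSet.wCharSet (TriSet.sat T)) :=
  corollary3p4_general T hT hvar
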